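/- Graphs are simple, undirected and without loops, and "countable" means finite or countably infinite. For a set $\mathcal C$ of finite graphs, a graph $G$ omits $\mathcal C$ (is $\mathcal C$-free) if no subgraph of $G$, induced or not, is isomorphic to a graph in $\mathcal C$. Let $\mathcal G_{\mathcal C}$ be the class of countable graphs omitting $\mathcal C$. A graph $G\in\mathcal G_{\mathcal C}$ is universal if every graph in $\mathcal G_{\mathcal C}$ is isomorphic to an induced subgraph of $G$. It is existentially complete if, for every $H\in\mathcal G_{\mathcal C}$ containing $G$ as an induced subgraph and all finite induced subgraphs $A$ of $G$ and $B$ of $H$ with $A\subseteq B$, there is an isomorphism of $B$ onto an induced subgraph of $G$ which is the identity on $A$. Let $T^*_{\mathcal C}$ be the set of all first-order sentences in the language of graphs that hold in every existentially complete graph in $\mathcal G_{\mathcal C}$. A theory is $\aleph_0$-categorical if it has exactly one countable model up to isomorphism. A set $\mathcal H$ of finite graphs is closed under homomorphic image if every homomorphic image of a graph in $\mathcal H$ contains a subgraph isomorphic to a graph in $\mathcal H$ (where a homomorphic image of a graph $K$ is a loopless graph $D$ admitting a homomorphism $K\to D$ that is surjective on vertices and on edges); in particular this holds if every homomorphic image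 of a graph in $\mathcal H$ is isomorphic to a graph in $\mathcal H$. Theorem 5. Let $\mathcal C$ be a finite set of finite connected graphs such that $T^*_{\mathcal C}$ is $\aleph_0$-categorical, and let $\mathcal H$ be a finite set of finite connected graphs which is closed under homomorphic image. Then $T^*_{\mathcal C\cup\mathcal H}$ is $\aleph_0$-categorical. Moreover, there is a universal graph in $\mathcal G_{\mathcal C\cup\mathcal H}$. -/

import Mathlib

open FirstOrder

namespace ForbiddenGraphs

/-- A finite graph (simple and undirected, hence without loops). -/
structure FinGraph where
  /-- the vertices -/
  V : Type
  [finite : Finite V]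
  /-- the graph on these vertices -/
  graph : SimpleGraph V

/-- `G` omits `C`: no subgraph of `G`, induced or not, is isomorphic to a graph in `C`. -/
def Omits (C : Set FinGraph) {V : Type} (G : SimpleGraph V) : Prop :=
  ∀ K ∈ C, K.graph.Free G

/-- Membership in the class of countable (finite or countably infinite) graphs omitting `C`. -/
def IsCountableFree (C : Set FinGraph) {V : Type} (G : SimpleGraph V) : Prop :=
  Countable V ∧ Omits C G

/-- `G` is universal for `C`: it is a countable graph omitting `C`, and every countable graph
omitting `C` is isomorphic to an induced subgraph of `G`. -/
def IsUniversal (C : Set FinGraph) {V : Type} (G : SimpleGraph V) : Prop :=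
  IsCountableFree C G ∧
    ∀ (W : Type) (G' : SimpleGraph W), IsCountableFree C G' → Nonempty (G' ↪g G)

/-- `G`, identified by `f` with an induced subgraph of `H`, is existentially complete in `H`:
whenever `A ⊆ B` are finite induced subgraphs of `G` and `H` respectively, there is an
isomorphism of `B` onto an induced subgraph of `G` that is the identity on `A`. -/
def IsExistentiallyCompleteIn {V W : Type} {G : SimpleGraph V} {H : SimpleGraph W}
    (f : G ↪g H) : Prop :=
  ∀ (A : Set V) (B : Set W), A.Finite → B.Finite → f '' A ⊆ B →
    ∃ g : H.induce B ↪g G, ∀ a ∈ A, ∀ b : B, f a = (b : W) → g b = a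

/-- Membership in the class of existentially complete countable graphs omitting `C`: `G` is
a countable graph omitting `C` that is existentially complete in each countable graph omitting `C`
which contains it as an induced subgraph. -/
def IsExistentiallyComplete (C : Set FinGraph) {V : Type} (G : SimpleGraph V) : Prop :=
  IsCountableFree C G ∧
    ∀ (W : Type) (H : SimpleGraph W), IsCountableFree C H →
      ∀ f : G ↪g H, IsExistentiallyCompleteIn f

/-- The first-order theory `T*_C` of the class of existentially complete graphs for `C`:
all sentences of the language of graphs that hold in every one of them. -/
def theoryStar (C : Set FinGraph) : Language.graph.Theory :=
  {φ | ∀ (V : Type) (G : SimpleGraph V), IsExistentiallyComplete C G →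
    @Language.Sentence.Realize Language.graph V G.structure φ}

/-- `ℵ₀`-categoricity: the theory has exactly one countable (finite or countably infinite) model,
up to isomorphism. -/
def IsAlephZeroCategorical {L : FirstOrder.Language.{0, 0}} (T : L.Theory) : Prop :=
  (∃ (V : Type) (_ : L.Structure V), Countable V ∧ V ⊨ T) ∧
    ∀ (V W : Type) [L.Structure V] [L.Structure W], Countable V → Countable W →
      V ⊨ T → W ⊨ T → Nonempty (V ≃[L] W)

/-- `D` is a homomorphic image of `G`: some homomorphism from `G` to `D` is onto the vertices
and onto the edges of `D`. -/
def IsHomImage {V W : Type} (G : SimpleGraph V) (D : SimpleGraph W) : Prop :=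
  ∃ f : G →g D, Function.Surjective f ∧
    ∀ u v, D.Adj u v → ∃ x y, G.Adj x y ∧ f x = u ∧ f y = v

/-- `H` is closed under homomorphic image: every homomorphic image of a graph in `H` contains
a graph in `H` as a subgraph. This holds in particular if every homomorphic image of a graph
in `H` is isomorphic to a graph in `H`. -/
def IsHomClosed (H : Set FinGraph) : Prop :=
  ∀ K ∈ H, ∀ D : FinGraph, IsHomImage K.graph D.graph → ∃ K' ∈ H, K'.graph.IsContained D.graph

end ForbiddenGraphs

open ForbiddenGraphs

/-!
Say that `C` has finitely many types if, for each `n`, finitely many existential types of `n`-tuples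
occur in the existentially complete graphs `G` for `C`. Finite tuples of `G` with the same
existential type are then conjugate under `Aut G`, by a back-and-forth argument, and every countable
model of `T*_C` is existentially complete; so, when the graphs in `C` are connected, `T*_C` is
`ℵ₀`-categorical and its countable model is universal. Conversely, if `T*_C` is `ℵ₀`-categorical,
then every type that occurs is isolated by a single pattern, since otherwise some existentially
complete graph would omit it. Infinitely many types would, by compactness, accumulate at a type
realized in a countable model, which could not be isolated.

To pass from `C` to `C ∪ H`, embed the existentially complete graphs for `C ∪ H` in a universal
graph `M` for `C`, with a given tuple `a` of `M` in their images. Let `B` be the algebraic closure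
of `a` in `M`, which is finite. By Neumann's lemma an automorphism of `M` over `B` can move a finite
set disjoint from `B` off any given finite set, hence the free amalgam of two copies of `M` over `B`
omits `C`. Two induced subgraphs `G`, `G'` of `M` with the same intersection with `B` can thus be
amalgamated over it without creating graphs of `C`. If moreover each partial map into `B` that a
homomorphism from a part of a graph of `H` to `G` induces is also induced by one to `G'`, then a
homomorphism from a graph of `H` to the amalgam can be rerouted through `G'`, which is impossible,
because `H` is closed under homomorphic image. There are finitely many possible sets of such partial
maps, hence finitely many types.
-/

namespace ForbiddenGraphs

instance (K : FinGraph) : Finite K.V := K.finite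

section Embeddings

variable {U V W : Type*} {F : SimpleGraph U} {G : SimpleGraph V} {H : SimpleGraph W}

theorem exists_embedding_lift (f : F ↪g H) (g : G ↪g H) (h : Set.range f ⊆ Set.range g) :
    ∃ e : F ↪g G, ∀ x, g (e x) = f x := by
  choose e he using fun x => h ⟨x, rfl⟩
  refine ⟨⟨⟨e, fun x y hxy => f.injective ?_⟩, fun {x y} => ?_⟩, he⟩
  · rw [← he, ← he, hxy]
  · change G.Adj (e x) (e y) ↔ F.Adj x y
    rw [← g.map_adj_iff, he, he, f.map_adj_iff]

theorem exists_embedding_induce (f : F ↪g H) {T : Set W} (h : Set.range f ⊆ T) :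
    ∃ e : F ↪g H.induce T, ∀ x, (e x : W) = f x :=
  exists_embedding_lift f (SimpleGraph.Embedding.induce T) (h.trans Subtype.range_coe.superset)

theorem isContained_of_range_subset (c : F.Copy H) (g : G ↪g H)
    (h : Set.range c ⊆ Set.range g) : F.IsContained G := by
  choose e he using fun x => h ⟨x, rfl⟩
  refine ⟨⟨⟨e, fun {x y} hxy => ?_⟩, fun x y hxy => c.injective ?_⟩⟩
  · rw [← g.map_adj_iff, he, he]
    exact c.toHom.map_adj hxy
  · change c x = c y
    rw [← he, ← he]
    exact congrArg g hxy

end Embeddings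

section Omits

variable {C : Set FinGraph} {V W : Type} {G : SimpleGraph V} {H : SimpleGraph W}

theorem Omits.of_embedding (h : Omits C H) (f : G ↪g H) : Omits C G := fun K hK hKG =>
  h K hK (hKG.trans ⟨f.toCopy⟩)

theorem IsCountableFree.of_embedding (h : IsCountableFree C H) (f : G ↪g H) :
    IsCountableFree C G :=
  have := h.1
  ⟨f.injective.countable, h.2.of_embedding f⟩

end Omits

/-- A finite graph with `n` marked vertices, possibly repeated. It plays the role of an existential
formula in `n` free variables: the diagram of the graph, with the other vertices quantified. -/
structure Pattern (n : ℕ) where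
  size : ℕ
  graph : SimpleGraph (Fin size)
  pt : Fin n → Fin size

instance (n : ℕ) : Countable (Pattern n) := by
  refine Function.Injective.countable (f := fun P : Pattern n =>
    (⟨P.size, P.graph, P.pt⟩ : Σ m, SimpleGraph (Fin m) × (Fin n → Fin m))) ?_
  rintro ⟨m, F, a⟩ ⟨_, _, _⟩ h
  cases h
  rfl

section Types

variable {n : ℕ} {U V W : Type*} {F : SimpleGraph U} {G : SimpleGraph V} {H : SimpleGraph W}
  {a : Fin n → V} {b : Fin n → W}

/-- The tuple `a` of `G` satisfies the existential formula `P`: some induced copy of `P` in `G` has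
the tuple `a` as its marked vertices. -/
def Pattern.Holds (P : Pattern n) (G : SimpleGraph V) (a : Fin n → V) : Prop :=
  ∃ g : P.graph ↪g G, g ∘ P.pt = a

/-- The existential type of the tuple `a` in `G`. Patterns suffice, as every existential formula is a
disjunction of them. -/
def exType (G : SimpleGraph V) (a : Fin n → V) : Set (Pattern n) :=
  {P | P.Holds G a}

theorem Pattern.Holds.map {P : Pattern n} (h : P.Holds G a) (f : G ↪g H) : P.Holds H (f ∘ a) := by
  obtain ⟨g, rfl⟩ := h
  exact ⟨f.comp g, rfl⟩

theorem exType_iso_comp (f : G ≃g H) (a : Fin n → V) : exType H (f ∘ a) = exType G a := by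
  refine Set.Subset.antisymm (fun P hP => ?_) fun P hP => hP.map f.toEmbedding
  have hPsymm : P.Holds G (f.symm ∘ f ∘ a) := hP.map f.symm.toEmbedding
  rwa [← Function.comp_assoc, RelIso.symm_comp_self] at hPsymm

/-- The existential formula which states that a finite graph with a marked tuple embeds. -/
noncomputable def Pattern.ofGraph [Finite U] (F : SimpleGraph U) (c : Fin n → U) : Pattern n where
  size := Nat.card U
  graph := F.map (Finite.equivFin U).toEmbedding
  pt := Finite.equivFin U ∘ c

theorem Pattern.holds_ofGraph [Finite U] {c : Fin n → U} :
    (Pattern.ofGraph F c).Holds G a ↔ ∃ g : F ↪g G, g ∘ c = a := by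
  let e : F ≃g (Pattern.ofGraph F c).graph := SimpleGraph.Iso.map (Finite.equivFin U) F
  constructor
  · rintro ⟨g, rfl⟩
    exact ⟨g.comp e.toEmbedding, rfl⟩
  · rintro ⟨g, rfl⟩
    refine ⟨g.comp e.symm.toEmbedding, funext fun i => congrArg g (e.symm_apply_apply (c i))⟩

theorem exists_embedding_of_exType_subset (h : exType G a ⊆ exType H b) {S : Set V}
    (hS : S.Finite) : ∃ g : G.induce (Set.range a ∪ S) ↪g H, ∀ i, g ⟨a i, .inl ⟨i, rfl⟩⟩ = b i := by
  have : Finite ↑(Set.range a ∪ S) := ((Set.finite_range a).union hS).to_subtype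
  let c : Fin n → ↑(Set.range a ∪ S) := fun i => ⟨a i, .inl ⟨i, rfl⟩⟩
  obtain ⟨g, hg⟩ := Pattern.holds_ofGraph.1
    (h (Pattern.holds_ofGraph (c := c).2 ⟨SimpleGraph.Embedding.induce _, rfl⟩))
  exact ⟨g, congrFun hg⟩

theorem eq_iff_eq_of_exType_subset (h : exType G a ⊆ exType H b) (i j : Fin n) :
    a i = a j ↔ b i = b j := by
  obtain ⟨g, hg⟩ := exists_embedding_of_exType_subset h Set.finite_empty
  rw [← hg, ← hg, g.injective.eq_iff]
  exact ⟨fun h => Subtype.ext h, congrArg Subtype.val⟩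

theorem adj_iff_adj_of_exType_subset (h : exType G a ⊆ exType H b) (i j : Fin n) :
    G.Adj (a i) (a j) ↔ H.Adj (b i) (b j) := by
  obtain ⟨g, hg⟩ := exists_embedding_of_exType_subset h Set.finite_empty
  rw [← hg, ← hg, g.map_adj_iff, SimpleGraph.comap_adj]
  rfl

theorem exists_pattern_imp {S : Set (Pattern n)} (hS : S.Finite) (hSa : S ⊆ exType G a) :
    ∃ Q ∈ exType G a, ∀ {W : Type*} (H : SimpleGraph W) (b : Fin n → W),
      Q ∈ exType H b → S ⊆ exType H b := by
  choose g hg using fun P : S => hSa P.2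
  have := hS.to_subtype
  have : Finite ↑(Set.range a ∪ ⋃ P, Set.range (g P)) :=
    (Set.finite_range a).union (Set.finite_iUnion fun P => Set.finite_range (g P))
  let c : Fin n → ↑(Set.range a ∪ ⋃ P, Set.range (g P)) := fun i => ⟨a i, .inl ⟨i, rfl⟩⟩
  refine ⟨Pattern.ofGraph (G.induce _) c,
    Pattern.holds_ofGraph.2 ⟨SimpleGraph.Embedding.induce _, rfl⟩, fun H b hb P hP => ?_⟩
  obtain ⟨f, rfl⟩ := Pattern.holds_ofGraph.1 hb
  obtain ⟨e, he⟩ := exists_embedding_induce (g ⟨P, hP⟩)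
    ((Set.subset_iUnion (fun P => Set.range (g P)) _).trans
      (Set.subset_union_right (s := Set.range a)))
  refine ⟨f.comp e, funext fun i => congrArg f (Subtype.ext ?_)⟩
  exact (he _).trans (congrFun (hg ⟨P, hP⟩) i)

end Types

section ExistentiallyComplete

variable {C : Set FinGraph} {V W : Type} {G : SimpleGraph V} {H : SimpleGraph W} {n : ℕ}

theorem isExistentiallyCompleteIn_iff (f : G ↪g H) :
    IsExistentiallyCompleteIn f ↔ ∀ (n : ℕ) (a : Fin n → V), exType H (f ∘ a) ⊆ exType G a := by
  constructor
  · rintro h n a P ⟨g, hg⟩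
    obtain ⟨e, he⟩ := h (Set.range a) (Set.range g) (Set.finite_range _) (Set.finite_range _) (by
      rw [← Set.range_comp, ← hg]
      exact Set.range_comp_subset_range _ _)
    obtain ⟨g', hg'⟩ := exists_embedding_induce g subset_rfl
    refine ⟨e.comp g', funext fun i => he _ ⟨i, rfl⟩ _ ?_⟩
    exact (congrFun hg i).symm.trans (hg' _).symm
  · intro h A B hA hB hAB
    obtain ⟨n, a, -, rfl⟩ := hA.fin_param
    have := hB.to_subtype
    let c : Fin n → B := fun i => ⟨f (a i), hAB ⟨_, ⟨i, rfl⟩, rfl⟩⟩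
    obtain ⟨g, hg⟩ := Pattern.holds_ofGraph.1 (h n a
      (Pattern.holds_ofGraph (c := c).2 ⟨SimpleGraph.Embedding.induce B, rfl⟩))
    refine ⟨g, ?_⟩
    rintro _ ⟨i, rfl⟩ b hb
    rw [← congrFun hg i]
    exact congrArg g (Subtype.ext hb.symm)

/-- A copy of a pattern in `H` lies, together with `G`, in a countable induced subgraph of `H`. -/
theorem IsExistentiallyComplete.exType_comp_eq (hG : IsExistentiallyComplete C G)
    (hH : Omits C H) (f : G ↪g H) (a : Fin n → V) : exType H (f ∘ a) = exType G a := by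
  refine Set.Subset.antisymm ?_ fun P hP => hP.map f
  rintro P ⟨g, hg⟩
  have := hG.1.1
  let T : Set W := Set.range f ∪ Set.range g
  have hT : IsCountableFree C (H.induce T) :=
    ⟨((Set.countable_range f).union (Set.countable_range g)).to_subtype,
      hH.of_embedding (SimpleGraph.Embedding.induce T)⟩
  obtain ⟨f', hf'⟩ := exists_embedding_induce f (T := T) Set.subset_union_left
  obtain ⟨g', hg'⟩ := exists_embedding_induce g (T := T) Set.subset_union_right
  refine (isExistentiallyCompleteIn_iff f').1 (hG.2 T _ hT f') n a
    ⟨g', funext fun i => Subtype.ext ?_⟩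
  exact (hg' _).trans ((congrFun hg i).trans (hf' _).symm)

end ExistentiallyComplete

section Conditions

variable {C : Set FinGraph} {X : Type} {S : Set X} {V W : Type} {G : SimpleGraph V}
  {H : SimpleGraph W} {n : ℕ}

/-- A forcing condition for the construction of existentially complete graphs: a graph omitting `C`
whose vertices are elements of an ambient set `X`, all but finitely many of them in `S`. The set `S`
is reserved for the graph to be extended. -/
structure Condition (C : Set FinGraph) {X : Type} (S : Set X) where
  verts : Set X
  graph : SimpleGraph verts
  finite : (verts \ S).Finite
  omits : Omits C graph

namespace Condition

instance : Preorder (Condition C S) where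
  le p q := ∃ i : p.graph ↪g q.graph, ∀ x, (i x : X) = x
  le_refl p := ⟨.refl, fun _ => rfl⟩
  le_trans _ _ _ := fun ⟨i, hi⟩ ⟨j, hj⟩ => ⟨j.comp i, fun x => (hj _).trans (hi x)⟩

/-- The condition which copies `H` along an injection of its vertices into the ambient set. -/
noncomputable def ofEmbedding (hH : Omits C H) (j : W ↪ X) (hj : (Set.range j \ S).Finite) :
    Condition C S where
  verts := Set.range j
  graph := H.map (Equiv.ofInjective j j.injective).toEmbedding
  finite := hj
  omits := hH.of_embedding
    (SimpleGraph.Iso.map (Equiv.ofInjective j j.injective) H).symm.toEmbedding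

theorem exists_iso_ofEmbedding (hH : Omits C H) (j : W ↪ X) (hj : (Set.range j \ S).Finite) :
    ∃ φ : H ≃g (ofEmbedding hH j hj).graph, ∀ w, (φ w : X) = j w :=
  ⟨SimpleGraph.Iso.map (Equiv.ofInjective j j.injective) H, fun _ => rfl⟩

theorem exists_extension (hS : Sᶜ.Infinite) (hH : Omits C H) (p : Condition C S)
    (f : p.graph ↪g H) {T : Set W} (hT : T.Finite) :
    ∃ (q : Condition C S) (i : p.graph ↪g q.graph) (f' : q.graph ↪g H),
      (∀ x, (i x : X) = x) ∧ (∀ x, f' (i x) = f x) ∧ T ⊆ Set.range f' := by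
  let T' : Set W := T \ Set.range f
  have hT' : Finite T' := hT.sdiff.to_subtype
  have hfree : (Sᶜ \ p.verts).Infinite := by
    refine (hS.sdiff p.finite).mono ?_
    rintro x ⟨hxS, hx⟩
    exact ⟨hxS, fun hxp => hx ⟨hxp, hxS⟩⟩
  have := hfree.to_subtype
  let new : T' ↪ ↥(Sᶜ \ p.verts) :=
    ((Finite.equivFin T').toEmbedding.trans Fin.valEmbedding).trans (Infinite.natEmbedding _)
  let h : p.verts ⊕ T' ↪ W := ⟨Sum.elim f Subtype.val, f.injective.sumElim
    Subtype.val_injective fun x t hxt => t.2.2 ⟨x, hxt⟩⟩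
  let j : p.verts ⊕ T' ↪ X := ⟨Sum.elim Subtype.val (Subtype.val ∘ new),
    Subtype.val_injective.sumElim (Subtype.val_injective.comp new.injective)
      fun x t hxt => (new t).2.2 (Set.mem_of_eq_of_mem hxt.symm x.2)⟩
  have hj : (Set.range j \ S).Finite := by
    refine (p.finite.union (Set.finite_range (Subtype.val ∘ new))).subset ?_
    rintro _ ⟨⟨x | t, rfl⟩, hx⟩
    · exact Or.inl ⟨x.2, hx⟩
    · exact Or.inr ⟨t, rfl⟩
  let h' : H.comap h ↪g H := SimpleGraph.Embedding.comap h H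
  obtain ⟨φ, hφ⟩ := exists_iso_ofEmbedding (hH.of_embedding h') j hj
  let inl : p.graph ↪g H.comap h := ⟨Function.Embedding.inl, f.map_adj_iff⟩
  refine ⟨_, φ.toEmbedding.comp inl, h'.comp φ.symm.toEmbedding, fun x => hφ _,
    fun x => congrArg h (φ.symm_apply_apply _), fun t ht => ?_⟩
  have hrange : Set.range (h' ∘ φ.symm) = Set.range h := φ.symm.surjective.range_comp h
  refine hrange.superset ?_
  by_cases htf : t ∈ Set.range f
  · obtain ⟨x, rfl⟩ := htf
    exact ⟨Sum.inl x, rfl⟩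
  · exact ⟨Sum.inr ⟨t, ht, htf⟩, rfl⟩

/-- The condition `p` forces `P` to hold at the tuple `a`. -/
def Realizes (p : Condition C S) (P : Pattern n) (a : Fin n → X) : Prop :=
  ∃ g : P.graph ↪g p.graph, Subtype.val ∘ g ∘ P.pt = a

theorem exists_realizes (hS : Sᶜ.Infinite) (hH : Omits C H) (p : Condition C S)
    (f : p.graph ↪g H) (a : Fin n → p.verts) {P : Pattern n} (hP : P ∈ exType H (f ∘ a)) :
    ∃ q ≥ p, q.Realizes P (Subtype.val ∘ a) := by
  obtain ⟨g, hg⟩ := hP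
  obtain ⟨q, i, f', hi, hf', hgf'⟩ := exists_extension hS hH p f (Set.finite_range g)
  obtain ⟨e, he⟩ := exists_embedding_lift g f' hgf'
  refine ⟨q, ⟨i, hi⟩, e, funext fun k => ?_⟩
  have hek : e (P.pt k) = i (a k) := f'.injective (by rw [he, hf']; exact congrFun hg k)
  exact (congrArg Subtype.val hek).trans (hi _)

/-- The conditions which decide whether `P` is going to hold at `a`. -/
def deciding (P : Pattern n) (a : Fin n → X) : Order.Cofinal (Condition C S) where
  carrier := {q | q.Realizes P a ∨ ∀ r ≥ q, ¬ r.Realizes P a}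
  isCofinal p := by
    by_cases! h : ∃ r ≥ p, r.Realizes P a
    · obtain ⟨r, hr, h⟩ := h
      exact ⟨r, Or.inl h, hr⟩
    · exact ⟨p, Or.inr h, le_rfl⟩

variable (I : Order.Ideal (Condition C S))

/-- The union of the conditions in an ideal, existentially complete if the ideal is sufficiently
generic. -/
def genericGraph : SimpleGraph {x : X // ∃ p ∈ I, x ∈ p.verts} where
  Adj x y := ∃ p ∈ I, ∃ (hx : x.1 ∈ p.verts) (hy : y.1 ∈ p.verts), p.graph.Adj ⟨x, hx⟩ ⟨y, hy⟩
  symm := ⟨fun _ _ ⟨p, hp, hx, hy, h⟩ => ⟨p, hp, hy, hx, h.symm⟩⟩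
  loopless := ⟨fun _ ⟨p, _, _, _, h⟩ => p.graph.irrefl h⟩

variable {I} {p : Condition C S}

/-- The inclusion of a condition in the union of an ideal to which it belongs. -/
def toGeneric (hp : p ∈ I) : p.graph ↪g genericGraph I where
  toFun x := ⟨x, p, hp, x.2⟩
  inj' _ _ hxy := Subtype.ext (Subtype.mk.inj hxy)
  map_rel_iff' {x y} := by
    refine ⟨fun ⟨q, hq, hx, hy, hxy⟩ => ?_, fun h => ⟨p, hp, x.2, y.2, h⟩⟩
    obtain ⟨r, -, ⟨i, hi⟩, ⟨j, hj⟩⟩ := I.directed p hp q hq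
    have hij : ∀ (z : p.verts) (hz : (z : X) ∈ q.verts), j ⟨z, hz⟩ = i z := fun z hz =>
      Subtype.ext ((hj _).trans (hi z).symm)
    rwa [← i.map_adj_iff, ← hij x hx, ← hij y hy, j.map_adj_iff]

theorem exists_toGeneric_range (hp : p ∈ I) {T : Set {x : X // ∃ p ∈ I, x ∈ p.verts}}
    (hT : T.Finite) : ∃ (q : Condition C S) (hq : q ∈ I), p ≤ q ∧ T ⊆ Set.range (toGeneric hq) := by
  induction T, hT using Set.Finite.induction_on with
  | empty => exact ⟨p, hp, le_rfl, Set.empty_subset _⟩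
  | @insert x T _ _ ih =>
    obtain ⟨q, hq, hpq, hT⟩ := ih
    obtain ⟨r, hr, hx⟩ := x.2
    obtain ⟨s, hs, hqs, ⟨i, hi⟩⟩ := I.directed q hq r hr
    refine ⟨s, hs, hpq.trans hqs, Set.insert_subset ⟨i ⟨x, hx⟩, Subtype.ext (hi _)⟩ ?_⟩
    obtain ⟨j, hj⟩ := hqs
    refine hT.trans ?_
    rintro _ ⟨y, rfl⟩
    exact ⟨j y, Subtype.ext (hj y)⟩

theorem Realizes.mem_exType (hp : p ∈ I) {P : Pattern n}
    {b : Fin n → {x : X // ∃ p ∈ I, x ∈ p.verts}} (h : p.Realizes P (Subtype.val ∘ b)) :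
    P ∈ exType (genericGraph I) b := by
  obtain ⟨g, hg⟩ := h
  exact ⟨(toGeneric hp).comp g, funext fun i => Subtype.ext (congrFun hg i)⟩

theorem omits_genericGraph (I : Order.Ideal (Condition C S)) : Omits C (genericGraph I) := by
  rintro K hK ⟨c⟩
  obtain ⟨p, hp⟩ := I.nonempty
  obtain ⟨q, hq, -, hc⟩ := exists_toGeneric_range hp (Set.finite_range c)
  exact q.omits K hK (isContained_of_range_subset c (toGeneric hq) hc)

theorem isExistentiallyComplete_genericGraph [Countable X] (hS : Sᶜ.Infinite)
    (hI : ∀ (n : ℕ) (P : Pattern n) (a : Fin n → X), ∃ q ∈ deciding P a, q ∈ I) :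
    IsExistentiallyComplete C (genericGraph I) := by
  refine ⟨⟨inferInstance, omits_genericGraph I⟩, fun W H hH f => ?_⟩
  rw [isExistentiallyCompleteIn_iff]
  intro n b P hP
  obtain ⟨q, hq, hqI⟩ := hI n P (Subtype.val ∘ b)
  refine hq.elim (Realizes.mem_exType hqI) fun hq => ?_
  obtain ⟨p, hp, hqp, hb⟩ := exists_toGeneric_range hqI (Set.finite_range b)
  choose a ha using fun i => hb ⟨i, rfl⟩
  obtain rfl : toGeneric hp ∘ a = b := funext ha
  obtain ⟨r, hpr, hr⟩ := exists_realizes hS hH.2 p (f.comp (toGeneric hp)) a hP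
  exact absurd hr (hq r (hqp.trans hpr))

theorem exists_isExistentiallyComplete_genericGraph [Countable X] (hS : Sᶜ.Infinite)
    (p : Condition C S) {ι : Type} [Countable ι] (𝒟 : ι → Order.Cofinal (Condition C S)) :
    ∃ I : Order.Ideal (Condition C S), p ∈ I ∧ (∀ i, ∃ q ∈ 𝒟 i, q ∈ I) ∧
      IsExistentiallyComplete C (genericGraph I) := by
  have := Encodable.ofCountable (ι ⊕ Σ n, Pattern n × (Fin n → X))
  let 𝒟' : (ι ⊕ Σ n, Pattern n × (Fin n → X)) → Order.Cofinal (Condition C S) :=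
    Sum.elim 𝒟 fun x => deciding x.2.1 x.2.2
  have hmeets := Order.cofinal_meets_idealOfCofinals p 𝒟'
  exact ⟨Order.idealOfCofinals p 𝒟', Order.mem_idealOfCofinals p 𝒟', fun i => hmeets (.inl i),
    isExistentiallyComplete_genericGraph hS fun n P a => hmeets (.inr ⟨n, P, a⟩)⟩

end Condition

open Condition

theorem exists_isExistentiallyComplete (hG : IsCountableFree C G) :
    ∃ (W : Type) (H : SimpleGraph W), IsExistentiallyComplete C H ∧ Nonempty (G ↪g H) := by
  have := hG.1
  have hS : (Set.range (Sum.inl : V → V ⊕ ℕ))ᶜ.Infinite := by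
    rw [Set.compl_range_inl]
    exact Set.infinite_range_of_injective Sum.inr_injective
  have hfin : (Set.range (Function.Embedding.inl : V ↪ V ⊕ ℕ) \ Set.range Sum.inl).Finite :=
    (Set.sdiff_self (s := Set.range (Sum.inl : V → V ⊕ ℕ))) ▸ Set.finite_empty
  let p : Condition C (Set.range (Sum.inl : V → V ⊕ ℕ)) :=
    ofEmbedding hG.2 Function.Embedding.inl hfin
  obtain ⟨φ, -⟩ := exists_iso_ofEmbedding hG.2 Function.Embedding.inl hfin
  obtain ⟨I, hp, -, hI⟩ := exists_isExistentiallyComplete_genericGraph hS p Empty.elim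
  exact ⟨_, _, hI, ⟨(toGeneric hp).comp φ.toEmbedding⟩⟩

section Omitting

variable {t : Set (Pattern n)} (ht : ∀ P ∈ t, ∃ (V : Type) (G : SimpleGraph V) (a : Fin n → V),
  Omits C G ∧ P ∈ exType G a ∧ ¬ exType G a ⊆ t)

include ht

theorem Condition.exists_realizes_notMem {p : Condition C (∅ : Set ℕ)} (a : Fin n → p.verts) :
    ∃ q ≥ p, ∃ P ∉ t, q.Realizes P (Subtype.val ∘ a) := by
  have : Finite p.verts := (Set.sdiff_empty ▸ p.finite :).to_subtype
  by_cases hp : Pattern.ofGraph p.graph a ∈ t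
  · obtain ⟨V, G, b, hG, hb, hbt⟩ := ht _ hp
    obtain ⟨f, rfl⟩ := Pattern.holds_ofGraph.1 hb
    obtain ⟨P, hP, hPt⟩ := Set.not_subset.1 hbt
    obtain ⟨q, hpq, hq⟩ := exists_realizes (by simpa using Set.infinite_univ) hG p f a hP
    exact ⟨q, hpq, P, hPt, hq⟩
  · obtain ⟨g, hg⟩ := Pattern.holds_ofGraph (F := p.graph) (c := a).2 ⟨.refl, rfl⟩
    exact ⟨p, le_rfl, _, hp, g, congrArg (Subtype.val ∘ ·) hg⟩

theorem exists_isExistentiallyComplete_forall_exType_ne (hC : Omits C (⊥ : SimpleGraph Empty)) :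
    ∃ (W : Type) (H : SimpleGraph W), IsExistentiallyComplete C H ∧
      ∀ b : Fin n → W, exType H b ≠ t := by
  let 𝒟 : (Fin n → ℕ) → Order.Cofinal (Condition C (∅ : Set ℕ)) := fun a =>
    { carrier := {q | (∃ P ∉ t, q.Realizes P a) ∨ ∀ r ≥ q, ¬ Set.range a ⊆ r.verts}
      isCofinal p := by
        by_cases! h : ∃ r ≥ p, Set.range a ⊆ r.verts
        · obtain ⟨r, hpr, hr⟩ := h
          obtain ⟨q, hrq, hq⟩ := exists_realizes_notMem ht fun i => (⟨a i, hr ⟨i, rfl⟩⟩ : r.verts)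
          exact ⟨q, Or.inl hq, hpr.trans hrq⟩
        · exact ⟨p, Or.inr h, le_rfl⟩ }
  obtain ⟨I, -, h𝒟, hI⟩ := exists_isExistentiallyComplete_genericGraph
    (by simpa using Set.infinite_univ) (ofEmbedding hC ⟨Empty.elim, nofun⟩ (Set.toFinite _)) 𝒟
  refine ⟨_, _, hI, fun b hb => ?_⟩
  obtain ⟨q, hq, hqI⟩ := h𝒟 (Subtype.val ∘ b)
  rcases hq with ⟨P, hPt, hP⟩ | hq
  · exact hPt (hb ▸ hP.mem_exType hqI)
  · obtain ⟨r, hr, hqr, hbr⟩ := exists_toGeneric_range hqI (Set.finite_range b)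
    refine hq r hqr ?_
    rintro _ ⟨i, rfl⟩
    obtain ⟨x, hx⟩ := hbr ⟨i, rfl⟩
    exact Set.mem_of_eq_of_mem (congrArg Subtype.val hx).symm x.2

end Omitting

end Conditions

section Ultrapower

open Filter

variable {ι : Type*} {V W : Type*} {G : SimpleGraph V} {H : SimpleGraph W} {n : ℕ}

/-- The ultrapower of a graph: two germs are adjacent if they are adjacent almost everywhere. -/
def ultrapower (u : Ultrafilter ι) (G : SimpleGraph V) : SimpleGraph ((u : Filter ι).Germ V) where
  Adj := Germ.LiftRel G.Adj
  symm := ⟨fun x y => Quotient.inductionOn₂' x y fun _ _ h => h.mono fun _ => G.adj_symm⟩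
  loopless := ⟨fun x => Quotient.inductionOn' x fun _ h => h.exists.elim fun _ => G.irrefl⟩

theorem ultrapower_adj_coe {u : Ultrafilter ι} {x y : ι → V} :
    (ultrapower u G).Adj x y ↔ ∀ᶠ i in u, G.Adj (x i) (y i) :=
  Iff.rfl

/-- The diagonal embedding of a graph in its ultrapower. -/
def ultrapowerDiagonal (u : Ultrafilter ι) (G : SimpleGraph V) : G ↪g ultrapower u G where
  toFun v := (v : (u : Filter ι).Germ V)
  inj' _ _ h := Germ.const_inj.1 h
  map_rel_iff' := eventually_const

theorem omits_ultrapower {C : Set FinGraph} {ι V : Type} {G : SimpleGraph V} (hG : Omits C G)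
    (u : Ultrafilter ι) : Omits C (ultrapower u G) := by
  rintro K hK ⟨c⟩
  have hrep : ∀ x, ∃ r : ι → V, (r : (u : Filter ι).Germ V) = c x := fun x =>
    Quotient.exists_rep (c x)
  choose r hr using hrep
  have hadj : ∀ᶠ i in u, ∀ x y, K.graph.Adj x y → G.Adj (r x i) (r y i) := by
    simp only [eventually_all]
    intro x y hxy
    rw [← ultrapower_adj_coe, hr, hr]
    exact c.toHom.map_adj hxy
  have hne : ∀ᶠ i in u, ∀ x y, r x i = r y i → x = y := by
    simp only [eventually_all, Ultrafilter.eventually_imp]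
    intro x y hxy
    have hcxy : c x = c y := by rwa [← hr, ← hr, Germ.coe_eq]
    exact .of_forall fun _ => c.injective hcxy
  obtain ⟨i, hadj, hne⟩ := (hadj.and hne).exists
  exact hG K hK ⟨⟨⟨fun x => r x i, hadj _ _⟩, fun x y => hne x y⟩⟩

theorem exists_embedding_ultrapower {a : Fin n → V} {b : Fin n → W}
    (h : exType G a ⊆ exType H b) : ∃ (u : Ultrafilter (Finset V)) (J : G ↪g ultrapower u H),
      J ∘ a = ultrapowerDiagonal u H ∘ b := by
  classical
  choose g hg using fun S : Finset V => exists_embedding_of_exType_subset h S.finite_toSet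
  let u : Ultrafilter (Finset V) := Ultrafilter.of atTop
  let j (x : V) (S : Finset V) : W :=
    if hx : x ∈ Set.range a ∪ S then g S ⟨x, hx⟩ else g {x} ⟨x, .inr (Finset.mem_singleton_self x)⟩
  have hj : ∀ x, ∀ᶠ S : Finset V in u, ∃ hx : x ∈ Set.range a ∪ S, j x S = g S ⟨x, hx⟩ := by
    intro x
    filter_upwards [Ultrafilter.of_le atTop (eventually_ge_atTop {x})] with S hS
    have hx : x ∈ Set.range a ∪ S := .inr (hS (Finset.mem_singleton_self x))
    exact ⟨hx, dif_pos hx⟩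
  refine ⟨u, ⟨⟨fun x => Germ.ofFun (j x), fun x y hxy => ?_⟩, fun {x y} => ?_⟩, ?_⟩
  · obtain ⟨S, hS, ⟨hx, hjx⟩, ⟨hy, hjy⟩⟩ :=
      ((Germ.coe_eq.1 hxy).and ((hj x).and (hj y))).exists
    exact congrArg Subtype.val ((g S).injective (hjx.symm.trans (hS.trans hjy)))
  · change (∀ᶠ S in u, H.Adj (j x S) (j y S)) ↔ G.Adj x y
    rw [← eventually_const (f := (u : Filter (Finset V))) (p := G.Adj x y)]
    refine eventually_congr ?_
    filter_upwards [hj x, hj y] with S ⟨hx, hjx⟩ ⟨hy, hjy⟩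
    rw [hjx, hjy, (g S).map_adj_iff]
    rfl
  · funext i
    refine Germ.coe_eq.2 (.of_forall fun S => ?_)
    exact (dif_pos (.inl ⟨i, rfl⟩)).trans (hg S i)

theorem IsExistentiallyComplete.exType_eq_of_subset {C : Set FinGraph} {V W : Type}
    {G : SimpleGraph V} {H : SimpleGraph W} (hG : IsExistentiallyComplete C G) (hH : Omits C H)
    {a : Fin n → V} {b : Fin n → W} (h : exType G a ⊆ exType H b) : exType G a = exType H b := by
  obtain ⟨u, J, hJ⟩ := exists_embedding_ultrapower h
  refine h.antisymm ?_
  rw [← hG.exType_comp_eq (omits_ultrapower hH u) J a, hJ]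
  exact fun P hP => hP.map (ultrapowerDiagonal u H)

end Ultrapower

/-- The existential types of `n`-tuples in the existentially complete graphs for `C`. -/
def realizedTypes (C : Set FinGraph) (n : ℕ) : Set (Set (Pattern n)) :=
  {t | ∃ (V : Type) (G : SimpleGraph V) (a : Fin n → V),
    IsExistentiallyComplete C G ∧ exType G a = t}

/-- Finitely many existential types of `n`-tuples are realized, for each `n`: this is the form in
which the condition of Engeler, Ryll-Nardzewski and Svenonius is used. -/
def FinitelyManyTypes (C : Set FinGraph) : Prop :=
  ∀ n, (realizedTypes C n).Finite

/-- Every realized existential type is isolated by one of its patterns. -/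
def TypesIsolated (C : Set FinGraph) : Prop :=
  ∀ n, ∀ t ∈ realizedTypes C n, ∃ P ∈ t, ∀ t' ∈ realizedTypes C n, P ∈ t' → t' = t

section BackAndForth

variable {C : Set FinGraph} {V W : Type} {G : SimpleGraph V} {H : SimpleGraph W} {n : ℕ}

theorem IsExistentiallyComplete.exType_mem (hG : IsExistentiallyComplete C G) (a : Fin n → V) :
    exType G a ∈ realizedTypes C n :=
  ⟨V, G, a, hG, rfl⟩

theorem FinitelyManyTypes.typesIsolated (hC : FinitelyManyTypes C) : TypesIsolated C := by
  rintro n _ ⟨V, G, a, hG, rfl⟩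
  have hsep : ∀ t ∈ realizedTypes C n \ {exType G a}, ∃ P ∈ exType G a, P ∉ t := by
    rintro _ ⟨⟨W, H, b, hH, rfl⟩, hne⟩
    exact Set.not_subset.1 fun h => hne (hG.exType_eq_of_subset hH.1.2 h).symm
  choose P hPa hP using fun t : ↥(realizedTypes C n \ {exType G a}) => hsep t t.2
  have := (hC n).sdiff.to_subtype (s := realizedTypes C n \ {exType G a})
  obtain ⟨Q, hQ, hQP⟩ := exists_pattern_imp (Set.finite_range P) (Set.range_subset_iff.2 hPa)
  refine ⟨Q, hQ, ?_⟩
  rintro _ ⟨W, H, b, hH, rfl⟩ hQb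
  by_contra hne
  exact hP ⟨_, hH.exType_mem b, hne⟩ (hQP H b hQb ⟨_, rfl⟩)

theorem TypesIsolated.exists_snoc (hC : TypesIsolated C) {a : Fin n → V} {b : Fin n → W}
    (hG : IsExistentiallyComplete C G) (hH : IsExistentiallyComplete C H)
    (h : exType G a = exType H b) (v : V) :
    ∃ w, exType G (Fin.snoc a v : Fin (n + 1) → V) = exType H (Fin.snoc b w : Fin (n + 1) → W) := by
  obtain ⟨P, ⟨f, hf⟩, hP⟩ := hC (n + 1) _ (hG.exType_mem (Fin.snoc a v))
  have hPa : (⟨P.size, P.graph, P.pt ∘ Fin.castSucc⟩ : Pattern n) ∈ exType G a :=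
    ⟨f, funext fun i => by simpa using congrFun hf i.castSucc⟩
  obtain ⟨g, rfl⟩ := h ▸ hPa
  refine ⟨g (P.pt (Fin.last n)), (hP _ (hH.exType_mem _) ⟨g, funext fun i => ?_⟩).symm⟩
  induction i using Fin.lastCases <;> simp

theorem exists_iso_of_correspondence {R : Set (V × W)} (hleft : ∀ v, ∃ w, (v, w) ∈ R)
    (hright : ∀ w, ∃ v, (v, w) ∈ R) (heq : ∀ x ∈ R, ∀ y ∈ R, x.1 = y.1 ↔ x.2 = y.2)
    (hadj : ∀ x ∈ R, ∀ y ∈ R, G.Adj x.1 y.1 ↔ H.Adj x.2 y.2) :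
    ∃ σ : G ≃g H, ∀ x ∈ R, σ x.1 = x.2 := by
  choose f hf using hleft
  have hfR : ∀ x ∈ R, f x.1 = x.2 := fun x hx => (heq _ (hf x.1) x hx).1 rfl
  have hbij : Function.Bijective f := by
    refine ⟨fun v v' h => (heq _ (hf v) _ (hf v')).2 h, fun w => ?_⟩
    obtain ⟨v, hv⟩ := hright w
    exact ⟨v, hfR _ hv⟩
  exact ⟨⟨Equiv.ofBijective f hbij, fun {v v'} => (hadj _ (hf v) _ (hf v')).symm⟩, hfR⟩

/-- Two tuples of the same existential type, stored as one tuple of pairs: a finite approximation to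
an isomorphism. -/
structure TypePair (G : SimpleGraph V) (H : SimpleGraph W) where
  len : ℕ
  pairs : Fin len → V × W
  eq : exType G (Prod.fst ∘ pairs) = exType H (Prod.snd ∘ pairs)

namespace TypePair

/-- The finite correspondence given by a pair of tuples. -/
def rel (x : TypePair G H) : Set (V × W) := Set.range x.pairs

instance : Preorder (TypePair G H) := Preorder.lift rel

/-- The pair of tuples obtained by appending `y` to `x`. -/
def snoc (x : TypePair G H) (y : V × W)
    (h : exType G (Fin.snoc (Prod.fst ∘ x.pairs) y.1 : Fin (x.len + 1) → V) =
      exType H (Fin.snoc (Prod.snd ∘ x.pairs) y.2 : Fin (x.len + 1) → W)) : TypePair G H where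
  len := x.len + 1
  pairs := Fin.snoc x.pairs y
  eq := by rwa [Fin.comp_snoc, Fin.comp_snoc]

theorem le_snoc (x : TypePair G H) (y : V × W) (h) : x ≤ x.snoc y h := by
  rintro _ ⟨i, rfl⟩
  exact ⟨i.castSucc, Fin.snoc_castSucc (α := fun _ => V × W) y x.pairs i⟩

theorem mem_rel_snoc (x : TypePair G H) (y : V × W) (h) : y ∈ (x.snoc y h).rel :=
  ⟨Fin.last _, Fin.snoc_last (α := fun _ => V × W) y x.pairs⟩

theorem exists_iso [Countable V] [Countable W]
    (hforth : ∀ (x : TypePair G H) v, ∃ y ≥ x, ∃ w, (v, w) ∈ y.rel)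
    (hback : ∀ (x : TypePair G H) w, ∃ y ≥ x, ∃ v, (v, w) ∈ y.rel) (x : TypePair G H) :
    ∃ σ : G ≃g H, ∀ y ∈ x.rel, σ y.1 = y.2 := by
  have := Encodable.ofCountable (V ⊕ W)
  let 𝒟 : V ⊕ W → Order.Cofinal (TypePair G H) := Sum.elim
    (fun v => ⟨{y | ∃ w, (v, w) ∈ y.rel}, fun x => (hforth x v).imp fun _ h => h.symm⟩)
    (fun w => ⟨{y | ∃ v, (v, w) ∈ y.rel}, fun x => (hback x w).imp fun _ h => h.symm⟩)
  let I := Order.idealOfCofinals x 𝒟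
  have hmeets := Order.cofinal_meets_idealOfCofinals x 𝒟
  have hcommon : ∀ p ∈ ⋃ y ∈ I, y.rel, ∀ q ∈ ⋃ y ∈ I, y.rel,
      ∃ z : TypePair G H, p ∈ z.rel ∧ q ∈ z.rel := by
    simp only [Set.mem_iUnion₂]
    rintro p ⟨y, hy, hp⟩ q ⟨y', hy', hq⟩
    obtain ⟨z, -, hyz, hyz'⟩ := I.directed y hy y' hy'
    exact ⟨z, hyz hp, hyz' hq⟩
  refine (exists_iso_of_correspondence (R := ⋃ y ∈ I, y.rel) ?_ ?_ ?_ ?_).imp fun σ hσ y hy =>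
    hσ y (Set.mem_biUnion (Order.mem_idealOfCofinals x 𝒟) hy)
  · intro v
    obtain ⟨y, ⟨w, hw⟩, hy⟩ := hmeets (.inl v)
    exact ⟨w, Set.mem_biUnion hy hw⟩
  · intro w
    obtain ⟨y, ⟨v, hv⟩, hy⟩ := hmeets (.inr w)
    exact ⟨v, Set.mem_biUnion hy hv⟩
  · intro p hp q hq
    obtain ⟨z, ⟨i, rfl⟩, ⟨j, rfl⟩⟩ := hcommon p hp q hq
    exact eq_iff_eq_of_exType_subset z.eq.subset i j
  · intro p hp q hq
    obtain ⟨z, ⟨i, rfl⟩, ⟨j, rfl⟩⟩ := hcommon p hp q hq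
    exact adj_iff_adj_of_exType_subset z.eq.subset i j

end TypePair

theorem TypesIsolated.exists_iso (hC : TypesIsolated C) {a : Fin n → V} {b : Fin n → W}
    (hG : IsExistentiallyComplete C G) (hH : IsExistentiallyComplete C H)
    (h : exType G a = exType H b) : ∃ σ : G ≃g H, σ ∘ a = b := by
  have := hG.1.1
  have := hH.1.1
  obtain ⟨σ, hσ⟩ := TypePair.exists_iso (G := G) (H := H)
    (fun x v => (hC.exists_snoc hG hH x.eq v).elim fun w hw =>
      ⟨x.snoc (v, w) hw, x.le_snoc _ _, w, x.mem_rel_snoc _ _⟩)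
    (fun x w => (hC.exists_snoc hH hG x.eq.symm w).elim fun v hv =>
      ⟨x.snoc (v, w) hv.symm, x.le_snoc _ _, v, x.mem_rel_snoc _ _⟩)
    ⟨n, fun i => (a i, b i), h⟩
  exact ⟨σ, funext fun i => hσ (a i, b i) ⟨i, rfl⟩⟩

end BackAndForth

section FirstOrder

open Language Filter

variable {C : Set FinGraph} {n : ℕ}

/-- The existential formula, in the language of graphs, which a pattern stands for. -/
noncomputable def Pattern.formula (P : Pattern n) : Language.graph.Formula (Fin n) :=
  Formula.iExs (Fin P.size)
    ((Formula.iInf fun i : Fin n => Term.equal (Term.var (.inr (P.pt i))) (Term.var (.inl i))) ⊓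
      (Formula.iInf fun x : {x : Fin P.size × Fin P.size // x.1 ≠ x.2} =>
        ∼(Term.equal (Term.var (.inr x.1.1)) (Term.var (.inr x.1.2)))) ⊓
      (Formula.iInf fun x : {x : Fin P.size × Fin P.size // P.graph.Adj x.1 x.2} =>
        adj.formula₂ (Term.var (.inr x.1.1)) (Term.var (.inr x.1.2))) ⊓
      Formula.iInf fun x : {x : Fin P.size × Fin P.size // ¬ P.graph.Adj x.1 x.2} =>
        ∼(adj.formula₂ (Term.var (.inr x.1.1)) (Term.var (.inr x.1.2))))

theorem Pattern.realize_formula (P : Pattern n) {V : Type*} (G : SimpleGraph V)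
    (a : Fin n → V) : @Formula.Realize _ V G.structure _ P.formula a ↔ P.Holds G a := by
  let := G.structure
  have hadj : ∀ x y : V, Structure.RelMap (L := Language.graph) adj ![x, y] ↔ G.Adj x y :=
    fun _ _ => Iff.rfl
  simp only [Pattern.formula, Formula.realize_iExs, Formula.realize_inf, Formula.realize_iInf,
    Formula.realize_not, Formula.realize_equal, Formula.realize_rel₂, Term.realize_var,
    Sum.elim_inl, Sum.elim_inr, hadj, Subtype.forall, Prod.forall]
  constructor
  · rintro ⟨g, ⟨⟨hpt, hinj⟩, hAdj⟩, hnAdj⟩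
    refine ⟨⟨⟨g, fun x y hxy => not_imp_not.1 (hinj x y) hxy⟩, fun {x y} => ?_⟩, funext hpt⟩
    exact ⟨not_imp_not.1 (hnAdj x y), hAdj x y⟩
  · rintro ⟨g, rfl⟩
    exact ⟨g, ⟨⟨fun _ => rfl, fun _ _ h => g.injective.ne h⟩, fun _ _ h => g.map_adj_iff.2 h⟩,
      fun _ _ h => mt g.map_adj_iff.1 h⟩

section Models

variable {V W : Type} {G : SimpleGraph V} {H : SimpleGraph W}

/-- `G`, as a first-order structure, is a model of `T*_C`. -/
def IsModel (C : Set FinGraph) (G : SimpleGraph V) : Prop :=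
  @Theory.Model Language.graph V G.structure (theoryStar C)

theorem IsExistentiallyComplete.isModel (hG : IsExistentiallyComplete C G) : IsModel C G :=
  let := G.structure
  ⟨fun _ hφ => hφ V G hG⟩

theorem exists_isModel [S : Language.graph.Structure V] (hV : V ⊨ theoryStar C) :
    ∃ G : SimpleGraph V, S = G.structure ∧ IsModel C G := by
  have : V ⊨ Theory.simpleGraph := ⟨fun φ hφ => hV.realize_of_mem φ fun _ G _ =>
    let := G.structure
    (simpleGraph_model G).realize_of_mem φ hφ⟩
  have hS : S = (simpleGraphOfStructure V).structure := structure_simpleGraphOfStructure.symm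
  refine ⟨_, hS, ?_⟩
  rwa [IsModel, ← hS]

theorem nonempty_equiv_structure_iff :
    Nonempty (@Language.Equiv Language.graph V W G.structure H.structure) ↔ Nonempty (G ≃g H) := by
  let := G.structure
  let := H.structure
  refine ⟨fun ⟨e⟩ => ⟨e.toEquiv, e.map_rel adj ![_, _]⟩, fun ⟨σ⟩ => ⟨σ.toEquiv, ?_, ?_⟩⟩
  · exact fun g => isEmptyElim g
  · rintro _ ⟨⟩ x
    exact σ.map_adj_iff

theorem isAlephZeroCategorical_theoryStar_iff : IsAlephZeroCategorical (theoryStar C) ↔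
    (∃ (V : Type) (G : SimpleGraph V), Countable V ∧ IsModel C G) ∧
      ∀ (V W : Type) (G : SimpleGraph V) (H : SimpleGraph W), Countable V → Countable W →
        IsModel C G → IsModel C H → Nonempty (G ≃g H) := by
  refine and_congr ⟨?_, ?_⟩ ⟨?_, ?_⟩
  · rintro ⟨V, _, hV, hmodel⟩
    obtain ⟨G, -, hG⟩ := exists_isModel hmodel
    exact ⟨V, G, hV, hG⟩
  · rintro ⟨V, G, hV, hG⟩
    exact ⟨V, G.structure, hV, hG⟩
  · intro h V W G H hV hW hG hH
    let := G.structure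
    let := H.structure
    exact nonempty_equiv_structure_iff.1 (h V W hV hW hG hH)
  · intro h V W _ _ hV hW hmodelV hmodelW
    obtain ⟨G, rfl, hG⟩ := exists_isModel hmodelV
    obtain ⟨H, rfl, hH⟩ := exists_isModel hmodelW
    exact nonempty_equiv_structure_iff.2 (h V W G H hV hW hG hH)

theorem IsModel.realize (hG : IsModel C G) (φ : Language.graph.Formula (Fin n))
    (h : ∀ (W : Type) (H : SimpleGraph W), IsExistentiallyComplete C H →
      ∀ b : Fin n → W, @Formula.Realize _ W H.structure _ φ b) (a : Fin n → V) :
    @Formula.Realize _ V G.structure _ φ a := by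
  let σ : Language.graph.Sentence :=
    Formula.iAlls (Fin n) (φ.relabel (Sum.inr : Fin n → Empty ⊕ Fin n))
  have hσ : ∀ (W : Type) [Language.graph.Structure W], W ⊨ σ ↔ ∀ b : Fin n → W, φ.Realize b := by
    intro W _
    simp only [Sentence.Realize, σ, Formula.realize_iAlls, Formula.realize_relabel]
    rfl
  let := G.structure
  have hmodel : V ⊨ theoryStar C := hG
  refine (hσ V).1 (hmodel.realize_of_mem σ fun W H hH => ?_) a
  let := H.structure
  exact (hσ W).2 (h W H hH)

theorem IsModel.omits (hG : IsModel C G) : Omits C G := by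
  rintro K hK ⟨c⟩
  let P : Pattern 0 := Pattern.ofGraph (G.induce (Set.range c)) Fin.elim0
  have hP : ∀ (W : Type) (H : SimpleGraph W), Omits C H → ∀ b : Fin 0 → W, ¬ P.Holds H b := by
    intro W H hH b hPb
    obtain ⟨g, -⟩ := Pattern.holds_ofGraph.1 hPb
    exact hH.of_embedding g K hK
      (isContained_of_range_subset c (SimpleGraph.Embedding.induce _) Subtype.range_coe.superset)
  have hPG : P.Holds G Fin.elim0 := Pattern.holds_ofGraph.2
    ⟨SimpleGraph.Embedding.induce _, Subsingleton.elim _ _⟩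
  refine hG.realize (∼P.formula) (fun W H hH b => ?_) _ ((P.realize_formula G _).2 hPG)
  exact fun hb => hP W H hH.1.2 b ((P.realize_formula H b).1 hb)

theorem IsModel.exists_mem_realizedTypes (hG : IsModel C G) (hC : FinitelyManyTypes C)
    (a : Fin n → V) : ∃ t ∈ realizedTypes C n, t ⊆ exType G a := by
  have : Finite (realizedTypes C n) := hC n
  choose Q hQt hQ using fun t : realizedTypes C n => hC.typesIsolated n t t.2
  have hcover := hG.realize (Formula.iSup fun t => (Q t).formula) (fun W H hH b => by
    let := H.structure
    exact Formula.realize_iSup.2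
      ⟨⟨_, hH.exType_mem b⟩, ((Q _).realize_formula H b).2 (hQt ⟨_, hH.exType_mem b⟩)⟩) a
  let := G.structure
  obtain ⟨t, ht⟩ := Formula.realize_iSup.1 hcover
  refine ⟨t, t.2, fun P hP => ?_⟩
  have himp := hG.realize ((Q t).formula.imp P.formula) (fun W H hH b => by
    let := H.structure
    rw [Formula.realize_imp, Pattern.realize_formula, Pattern.realize_formula]
    intro hQb
    change P ∈ exType H b
    rwa [hQ t _ (hH.exType_mem b) hQb]) a
  exact (P.realize_formula G a).1 (Formula.realize_imp.1 himp ht)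

theorem IsModel.isExistentiallyComplete [Countable V] (hG : IsModel C G)
    (hC : FinitelyManyTypes C) : IsExistentiallyComplete C G := by
  refine ⟨⟨inferInstance, hG.omits⟩, fun W H hH f => ?_⟩
  obtain ⟨W', H', hH', ⟨g⟩⟩ := exists_isExistentiallyComplete hH
  refine (isExistentiallyCompleteIn_iff f).2 fun n a P hP => ?_
  obtain ⟨_, ⟨V', G', a', hG', rfl⟩, hsub⟩ := hG.exists_mem_realizedTypes hC a
  have hsub' : exType G' a' ⊆ exType H' (g ∘ f ∘ a) := fun Q hQ => ((hsub hQ).map f).map g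
  apply hsub
  rw [hG'.exType_eq_of_subset hH'.1.2 hsub']
  exact hP.map g

end Models

section Categorical

theorem exists_isExistentiallyComplete_of_categorical
    (hC : IsAlephZeroCategorical (theoryStar C)) :
    ∃ (V : Type) (G : SimpleGraph V), IsExistentiallyComplete C G := by
  obtain ⟨⟨V, G, hV, hG⟩, -⟩ := isAlephZeroCategorical_theoryStar_iff.1 hC
  obtain ⟨W, H, hH, -⟩ := exists_isExistentiallyComplete ⟨hV, hG.omits⟩
  exact ⟨W, H, hH⟩

variable {V W : Type} {G : SimpleGraph V} {H : SimpleGraph W}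

theorem IsExistentiallyComplete.nonempty_iso (hG : IsExistentiallyComplete C G)
    (hH : IsExistentiallyComplete C H) (hC : IsAlephZeroCategorical (theoryStar C)) :
    Nonempty (G ≃g H) :=
  (isAlephZeroCategorical_theoryStar_iff.1 hC).2 V W G H hG.1.1 hH.1.1 hG.isModel hH.isModel

theorem typesIsolated_of_categorical (hC : IsAlephZeroCategorical (theoryStar C)) :
    TypesIsolated C := by
  rintro n _ ⟨V, G, a, hG, rfl⟩
  by_contra! hcon
  have hempty : Omits C (⊥ : SimpleGraph Empty) := hG.1.2.of_embedding
    ⟨⟨Empty.elim, fun x => x.elim⟩, fun {x} => x.elim⟩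
  obtain ⟨W, H, hH, hne⟩ := exists_isExistentiallyComplete_forall_exType_ne (t := exType G a)
    (fun P hP => by
      obtain ⟨_, ⟨V', G', a', hG', rfl⟩, hP', hne⟩ := hcon P hP
      exact ⟨V', G', a', hG'.1.2, hP', fun h => hne (hG'.exType_eq_of_subset hG.1.2 h)⟩) hempty
  obtain ⟨σ⟩ := hG.nonempty_iso hH hC
  exact hne _ (exType_iso_comp σ a)

theorem exists_countable_elementaryEmbedding (L : FirstOrder.Language.{0, 0}) [Countable L.Symbols]
    (M : Type) [L.Structure M] {s : Set M} (hs : s.Countable) :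
    ∃ (N : Type) (_ : L.Structure N) (ι : N ↪ₑ[L] M), Countable N ∧ s ⊆ Set.range ι := by
  by_cases hM : Countable M
  · exact ⟨M, inferInstance, ElementaryEmbedding.refl _ _, hM, fun x _ => ⟨x, rfl⟩⟩
  · have hM' : Cardinal.aleph0 ≤ Cardinal.mk M :=
      (lt_of_not_ge (mt Cardinal.mk_le_aleph0_iff.1 hM)).le
    have hL : L.card ≤ Cardinal.aleph0 := Cardinal.mk_le_aleph0_iff.2 inferInstance
    obtain ⟨N, hsN, hN⟩ := exists_elementarySubstructure_card_eq L s Cardinal.aleph0.{0}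
      le_rfl (by simpa using hs) (by simpa using hL) (by simpa using hM')
    refine ⟨N, inferInstance, N.subtype, ?_, fun x hx => ⟨⟨x, hsN hx⟩, rfl⟩⟩
    rw [← Cardinal.mk_le_aleph0_iff]
    simpa using hN.le

/-- The type `t` is that of a limit of the tuples `a k`: their class in an ultrapower, moved back
into `G` through a countable elementary substructure. -/
theorem exists_realizedType_forall_infinite (hC : IsAlephZeroCategorical (theoryStar C))
    (hG : IsExistentiallyComplete C G) (a : ℕ → Fin n → V) :
    ∃ t ∈ realizedTypes C n, ∀ P ∈ t, {k | P ∈ exType G (a k)}.Infinite := by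
  rcases isEmpty_or_nonempty V with hV | hV
  · refine ⟨_, hG.exType_mem (a 0), fun P hP => Set.infinite_of_forall_exists_gt fun k => ?_⟩
    exact ⟨k + 1, by rwa [Set.mem_ofPred_eq, Subsingleton.elim (a _) (a 0)], k.lt_succ_self⟩
  let := G.structure
  let u : Ultrafilter ℕ := hyperfilter ℕ
  let M := (u : Filter ℕ).Product fun _ => V
  have hM : M ⊨ theoryStar C := ⟨fun φ hφ =>
    (Ultraproduct.sentence_realize φ).2 (Eventually.of_forall fun _ => hφ V G hG)⟩
  let c : Fin n → M := fun i => ((fun k => a k i : ℕ → V) : (u : Filter ℕ).Product fun _ => V)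
  have hLos : ∀ P : Pattern n, P.formula.Realize c → {k | P ∈ exType G (a k)}.Infinite := by
    intro P hP hfin
    refine notMem_hyperfilter_of_finite hfin ?_
    refine Eventually.mono ((Ultraproduct.realize_formula_cast (M := fun _ : ℕ => V) (u := u)
      P.formula fun i k => a k i).1 hP) fun k hk => ?_
    exact (P.realize_formula G _).1 hk
  have : Countable Language.graph.Symbols :=
    have : ∀ l, Countable (Language.graph.Functions l) := fun _ => inferInstanceAs (Countable Empty)
    inferInstanceAs (Countable (_ ⊕ _))
  obtain ⟨N, _, ι, hN, hc⟩ :=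
    exists_countable_elementaryEmbedding Language.graph M (Set.finite_range c).countable
  obtain ⟨e⟩ := hC.2 N V hN hG.1.1 ((ι.theory_model_iff _).2 hM) hG.isModel
  choose d hd using fun i => hc ⟨i, rfl⟩
  refine ⟨_, hG.exType_mem (e ∘ d), fun P hP => hLos P ?_⟩
  have hPd : P.formula.Realize (e ∘ d) := (P.realize_formula G _).2 hP
  rwa [StrongHomClass.realize_formula, ← ι.map_formula, (funext hd : ι ∘ d = c)] at hPd

theorem finite_range_exType_of_categorical (hC : IsAlephZeroCategorical (theoryStar C))
    (hG : IsExistentiallyComplete C G) (n : ℕ) :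
    (Set.range fun a : Fin n → V => exType G a).Finite := by
  by_contra hinf
  let p := Set.Infinite.natEmbedding _ hinf
  choose a ha using fun k => (p k).2
  obtain ⟨t, ht, htP⟩ := exists_realizedType_forall_infinite hC hG a
  obtain ⟨P, hP, hPt⟩ := typesIsolated_of_categorical hC n t ht
  obtain ⟨k, hk, l, hl, hne⟩ := (htP P hP).nontrivial
  refine hne (p.injective (Subtype.ext ?_))
  rw [← ha k, ← ha l]
  exact (hPt _ (hG.exType_mem _) hk).trans (hPt _ (hG.exType_mem _) hl).symm

theorem finitelyManyTypes_of_categorical (hC : IsAlephZeroCategorical (theoryStar C)) :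
    FinitelyManyTypes C := by
  obtain ⟨V, G, hG⟩ := exists_isExistentiallyComplete_of_categorical hC
  refine fun n => (finite_range_exType_of_categorical hC hG n).subset ?_
  rintro _ ⟨W, H, b, hH, rfl⟩
  obtain ⟨σ⟩ := hH.nonempty_iso hG hC
  exact ⟨σ ∘ b, exType_iso_comp σ b⟩

end Categorical

end FirstOrder

section GroupActions

open MulAction

variable {Γ X : Type*} [Group Γ] [MulAction Γ X]

open scoped Pointwise in
/-- P. M. Neumann's separation lemma. -/
theorem exists_smul_notMem_of_infinite_orbits {S R : Set X} (hS : S.Finite) (hR : R.Finite)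
    (h : ∀ x ∈ R, (orbit Γ x).Infinite) : ∃ g : Γ, ∀ x ∈ R, g • x ∉ S := by
  classical
  by_contra! hcon
  let s : Finset (X × X) := {p ∈ hR.toFinset ×ˢ hS.toFinset | ∃ g : Γ, g • p.1 = p.2}
  have hs : ∀ p ∈ s, ∃ g : Γ, g • p.1 = p.2 := fun p hp => (Finset.mem_filter.1 hp).2
  choose! g hg using hs
  have hcover : ⋃ p ∈ s, g p • (stabilizer Γ p.1 : Set Γ) = Set.univ := by
    refine Set.eq_univ_of_forall fun t => ?_
    obtain ⟨x, hx, hxS⟩ := hcon t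
    have hp : (x, t • x) ∈ s := by simp [s, hx, hxS]
    refine Set.mem_biUnion hp ?_
    rw [mem_leftCoset_iff, SetLike.mem_coe, mem_stabilizer_iff, mul_smul, inv_smul_eq_iff]
    exact (hg _ hp).symm
  obtain ⟨p, hp, hfin⟩ := Subgroup.exists_finiteIndex_of_leftCoset_cover hcover
  have hpR : p.1 ∈ R := by simp_all [s]
  have := Finite.of_equiv _ (orbitEquivQuotientStabilizer Γ p.1).symm
  exact h _ hpR (Set.toFinite _)

theorem finiteIndex_stabilizer_iff_finite_orbit {x : X} :
    (stabilizer Γ x).FiniteIndex ↔ (orbit Γ x).Finite := by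
  rw [Subgroup.finiteIndex_iff, index_stabilizer]
  exact ⟨Set.finite_of_ncard_ne_zero, fun h => Set.ncard_ne_zero_of_mem (mem_orbit_self x) h⟩

theorem finiteIndex_fixingSubgroup {S : Set X} (hS : S.Finite)
    (h : ∀ x ∈ S, (orbit Γ x).Finite) : (fixingSubgroup Γ S).FiniteIndex := by
  have := hS.to_subtype
  have heq : fixingSubgroup Γ S = ⨅ x : S, stabilizer Γ (x : X) := by
    ext g
    simp [mem_fixingSubgroup_iff]
  rw [heq]
  exact Subgroup.finiteIndex_iInf fun x => finiteIndex_stabilizer_iff_finite_orbit.2 (h x x.2)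

theorem finite_orbit_of_finiteIndex (Δ : Subgroup Γ) [Δ.FiniteIndex] {x : X}
    (h : (orbit ↥Δ x).Finite) : (orbit Γ x).Finite := by
  rw [← finiteIndex_stabilizer_iff_finite_orbit] at h ⊢
  have hrel : (stabilizer Γ x).relIndex Δ ≠ 0 := h.index_ne_zero
  have hΔ : Δ.relIndex ⊤ ≠ 0 := by
    rw [Subgroup.relIndex_top_right]
    exact Subgroup.FiniteIndex.index_ne_zero
  rw [Subgroup.finiteIndex_iff, ← Subgroup.relIndex_top_right]
  exact Subgroup.relIndex_ne_zero_trans hrel hΔ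

theorem exists_fixing_smul_notMem (hfin : {x : X | (orbit Γ x).Finite}.Finite) {S R : Set X}
    (hS : S.Finite) (hR : R.Finite) (h : ∀ x ∈ R, (orbit Γ x).Infinite) :
    ∃ g ∈ fixingSubgroup Γ {x : X | (orbit Γ x).Finite}, ∀ x ∈ R, g • x ∉ S := by
  have := finiteIndex_fixingSubgroup (Γ := Γ) hfin fun _ hx => hx
  obtain ⟨g, hg⟩ := exists_smul_notMem_of_infinite_orbits
    (Γ := fixingSubgroup Γ {x : X | (orbit Γ x).Finite}) hS hR
    fun x hx => mt (finite_orbit_of_finiteIndex _) (h x hx)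
  exact ⟨g, g.2, hg⟩

end GroupActions

section Double

/-- Two copies of the graph `G` amalgamated over their common part `B`, without edges between the
rest of one copy and the rest of the other. -/
def double {V : Type*} (G : SimpleGraph V) (B : Set V) : SimpleGraph (V ⊕ ↥Bᶜ) where
  Adj p q := G.Adj (Sum.elim id (↑) p) (Sum.elim id (↑) q) ∧
    (p.isLeft = q.isLeft ∨ Sum.elim id (↑) p ∈ B ∨ Sum.elim id (↑) q ∈ B)
  symm := ⟨fun _ _ h => ⟨h.1.symm, h.2.imp Eq.symm Or.symm⟩⟩
  loopless := ⟨fun _ h => G.irrefl h.1⟩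

/-- The homomorphism from `double G B` to `G` that applies to the second copy an automorphism which
fixes the common part. -/
def doubleHom {V : Type*} {G : SimpleGraph V} {B : Set V} (σ : G ≃g G) (hσ : ∀ x ∈ B, σ x = x) :
    double G B →g G where
  toFun := Sum.elim id (σ ∘ (↑))
  map_rel' := by
    rintro (x | ⟨x, hx⟩) (y | ⟨y, hy⟩) ⟨hadj, h⟩
    · exact hadj
    · have hxB : x ∈ B := by simpa [show y ∉ B from hy] using h
      change G.Adj x (σ y)
      rw [← hσ x hxB]
      exact σ.map_adj_iff.2 hadj
    · have hyB : y ∈ B := by simpa [show x ∉ B from hx] using h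
      change G.Adj (σ x) y
      rw [← hσ y hyB]
      exact σ.map_adj_iff.2 hadj
    · exact σ.map_adj_iff.2 hadj

theorem omits_double_of_exists_iso {C : Set FinGraph} {V : Type} {G : SimpleGraph V} {B : Set V}
    (hG : Omits C G) (h : ∀ S R : Set V, S.Finite → R.Finite → R ⊆ Bᶜ →
      ∃ σ : G ≃g G, (∀ x ∈ B, σ x = x) ∧ ∀ x ∈ R, σ x ∉ S) : Omits C (double G B) := by
  rintro K hK ⟨c⟩
  have hfin : (Set.range c).Finite := Set.finite_range c
  obtain ⟨σ, hσB, hσ⟩ := h (Sum.inl ⁻¹' Set.range c) ((↑) '' (Sum.inr ⁻¹' Set.range c))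
    (hfin.preimage Sum.inl_injective.injOn) ((hfin.preimage Sum.inr_injective.injOn).image _)
    (Subtype.coe_image_subset _ _)
  have hne : ∀ (x : V) (y : ↥Bᶜ), .inl x ∈ Set.range c → .inr y ∈ Set.range c → x ≠ σ y := by
    rintro _ y hx hy rfl
    exact hσ y ⟨y, hy, rfl⟩ hx
  have hinj : Set.InjOn (doubleHom σ hσB) (Set.range c) := by
    rintro (x | x) hx (y | y) hy hxy
    · exact congrArg Sum.inl hxy
    · exact (hne x y hx hy hxy).elim
    · exact (hne y x hy hx hxy.symm).elim
    · exact congrArg Sum.inr (Subtype.ext (σ.injective hxy))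
  exact hG K hK ⟨(doubleHom σ hσB).comp c.toHom,
    fun x y hxy => c.injective (hinj ⟨x, rfl⟩ ⟨y, rfl⟩ hxy)⟩

end Double

section AlgClosure

variable {V : Type*} {G : SimpleGraph V} {n : ℕ}

/-- The algebraic closure of the tuple `a` in `G`: the vertices with finitely many conjugates under
the automorphisms of `G` that fix `a`. -/
def algClosure (G : SimpleGraph V) (a : Fin n → V) : Set V :=
  {x | (MulAction.orbit (fixingSubgroup (G ≃g G) (Set.range a)) x).Finite}

theorem mem_algClosure (G : SimpleGraph V) (a : Fin n → V) (i : Fin n) : a i ∈ algClosure G a := by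
  refine (Set.finite_singleton (a i)).subset ?_
  rintro _ ⟨σ, rfl⟩
  exact (mem_fixingSubgroup_iff _).1 σ.2 _ ⟨i, rfl⟩

variable {C : Set FinGraph} {V : Type} {G : SimpleGraph V}

theorem TypesIsolated.mem_orbit_fixingSubgroup (hC : TypesIsolated C)
    (hG : IsExistentiallyComplete C G) {a : Fin n → V} {x y : V}
    (h : exType G (Fin.snoc a x : Fin (n + 1) → V) = exType G (Fin.snoc a y : Fin (n + 1) → V)) :
    y ∈ MulAction.orbit (fixingSubgroup (G ≃g G) (Set.range a)) x := by
  obtain ⟨σ, hσ⟩ := hC.exists_iso hG hG h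
  refine ⟨⟨σ, (mem_fixingSubgroup_iff _).2 (Set.forall_mem_range.2 fun i => ?_)⟩, ?_⟩
  · simpa using congrFun hσ i.castSucc
  · simpa using congrFun hσ (Fin.last n)

theorem FinitelyManyTypes.finite_algClosure (hC : FinitelyManyTypes C)
    (hG : IsExistentiallyComplete C G) (a : Fin n → V) : (algClosure G a).Finite := by
  refine Set.Finite.of_finite_fibers (fun x => exType G (Fin.snoc a x : Fin (n + 1) → V))
    ((hC (n + 1)).subset ?_) ?_
  · rintro _ ⟨x, -, rfl⟩
    exact hG.exType_mem _
  · rintro _ ⟨x, hx, rfl⟩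
    exact Set.Finite.subset hx fun y hy => hC.typesIsolated.mem_orbit_fixingSubgroup hG hy.2.symm

theorem FinitelyManyTypes.omits_double_algClosure (hC : FinitelyManyTypes C)
    (hG : IsExistentiallyComplete C G) (a : Fin n → V) : Omits C (double G (algClosure G a)) := by
  refine omits_double_of_exists_iso hG.1.2 fun S R hS hR hRB => ?_
  obtain ⟨σ, hσfix, hσ⟩ := exists_fixing_smul_notMem
    (Γ := fixingSubgroup (G ≃g G) (Set.range a)) (hC.finite_algClosure hG a) hS hR hRB
  exact ⟨σ.1, (mem_fixingSubgroup_iff _).1 hσfix, hσ⟩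

end AlgClosure

section HomClosed

variable {C H : Set FinGraph} {U V W : Type} {M : SimpleGraph U} {G : SimpleGraph V}
  {G' : SimpleGraph W} {B : Set U} {n : ℕ}

theorem IsHomClosed.isEmpty_hom (hH : IsHomClosed H) (hG : Omits H G) {K : FinGraph}
    (hK : K ∈ H) : IsEmpty (K.graph →g G) := by
  refine ⟨fun φ => ?_⟩
  have hfin : Finite (Set.range φ) := Set.finite_range φ
  let D : SimpleGraph (Set.range φ) :=
    { Adj := fun u v => ∃ x y, K.graph.Adj x y ∧ φ x = u ∧ φ y = v
      symm := ⟨fun _ _ ⟨x, y, h, hx, hy⟩ => ⟨y, x, h.symm, hy, hx⟩⟩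
      loopless := ⟨fun _ ⟨_, _, h, hx, hy⟩ => (φ.map_adj h).ne (hx.trans hy.symm)⟩ }
  have hD : IsHomImage K.graph D :=
    ⟨⟨fun x => ⟨φ x, x, rfl⟩, fun {x y} h => ⟨x, y, h, rfl, rfl⟩⟩,
      fun ⟨_, x, hx⟩ => ⟨x, Subtype.ext hx⟩,
      fun _ _ ⟨x, y, h, hx, hy⟩ => ⟨x, y, h, Subtype.ext hx, Subtype.ext hy⟩⟩
  let ι : D →g G := ⟨(↑), by
    rintro _ _ ⟨x, y, h, hx, hy⟩
    rw [← hx, ← hy]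
    exact φ.map_adj h⟩
  obtain ⟨K', hK', hK'D⟩ := hH K hK ⟨Set.range φ, D⟩ hD
  exact hG K' hK' (hK'D.trans ⟨ι, Subtype.val_injective⟩)

/-- The embedding of `M` onto the first of the two copies in `double M B`. -/
def doubleLeft (M : SimpleGraph U) (B : Set U) : M ↪g double M B where
  toEmbedding := ⟨Sum.inl, Sum.inl_injective⟩
  map_rel_iff' := and_iff_left (Or.inl rfl)

open Classical in
/-- The embedding of `M` onto the second of the two copies in `double M B`. -/
noncomputable def doubleRight (M : SimpleGraph U) (B : Set U) : M ↪g double M B where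
  toFun x := if hx : x ∈ B then .inl x else .inr ⟨x, hx⟩
  inj' x y hxy := by
    by_cases hx : x ∈ B <;> by_cases hy : y ∈ B <;> simp_all
  map_rel_iff' {x y} := by
    change (double M B).Adj (if hx : x ∈ B then .inl x else .inr ⟨x, hx⟩)
      (if hy : y ∈ B then .inl y else .inr ⟨y, hy⟩) ↔ _
    by_cases hx : x ∈ B <;> by_cases hy : y ∈ B <;> simp [double, hx, hy]

theorem doubleRight_of_mem {x : U} (hx : x ∈ B) : doubleRight M B x = doubleLeft M B x :=
  dif_pos hx

theorem doubleRight_of_notMem {x : U} (hx : x ∉ B) : doubleRight M B x = .inr ⟨x, hx⟩ :=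
  dif_neg hx

theorem double_adj_left_right {x y : U} (hy : y ∉ B) :
    (double M B).Adj (doubleLeft M B x) (doubleRight M B y) ↔ M.Adj x y ∧ x ∈ B := by
  rw [doubleRight_of_notMem hy]
  change (double M B).Adj (.inl x) _ ↔ _
  simp [double, hy]

/-- The partial homomorphisms from graphs in `H` to a subgraph `G` of `M`, each one recorded by its
domain and by the pairs `(x, b)` such that `x` is sent to `b ∈ B`. -/
def traces (H : Set FinGraph) (B : Set U) (g : G ↪g M) :
    Set (Σ K : H, Set K.1.V × Set (K.1.V × B)) :=
  {p | ∃ φ : p.1.1.graph.induce p.2.1 →g G, ∀ x b, (x.1, b) ∈ p.2.2 ↔ g (φ x) = b}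

/-- Replacing, in a homomorphism to the amalgam of `G` and `G'` in `double M B`, the part that goes
to `G` by one that goes to `G'`. -/
theorem nonempty_hom_of_traces_subset {g : G ↪g M} {g' : G' ↪g M}
    (hB : B ∩ Set.range g' ⊆ Set.range g) (ht : traces H B g ⊆ traces H B g') {K : FinGraph}
    (hK : K ∈ H) (c : K.graph →g double M B)
    (hc : ∀ x, c x ∈ Set.range (doubleLeft M B ∘ g) ∪ Set.range (doubleRight M B ∘ g')) :
    Nonempty (K.graph →g G') := by
  classical
  let s : Set K.V := {x | c x ∈ Set.range (doubleLeft M B ∘ g)}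
  obtain ⟨φ, hφ⟩ : ∃ φ : s → V, ∀ x, doubleLeft M B (g (φ x)) = c x :=
    Classical.skolem.1 fun x : s => x.2
  let φhom : K.graph.induce s →g G := ⟨φ, fun {x y} hxy => by
    rw [← g.map_adj_iff, ← (doubleLeft M B).map_adj_iff, hφ, hφ]
    exact c.map_adj hxy⟩
  obtain ⟨φ', hφ'⟩ : ∃ φ' : K.graph.induce s →g G', ∀ x, ∀ b ∈ B, g (φ x) = b → g' (φ' x) = b := by
    obtain ⟨φ', hφ'⟩ := ht (a := ⟨⟨K, hK⟩, s, {p | ∃ h : p.1 ∈ s, g (φ ⟨p.1, h⟩) = p.2}⟩)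
      ⟨φhom, fun x b => ⟨fun h => h.2, fun h => ⟨x.2, h⟩⟩⟩
    exact ⟨φ', fun x b hb h => (hφ' x ⟨b, hb⟩).1 ⟨x.2, h⟩⟩
  obtain ⟨ψ, hψ⟩ : ∃ ψ : ↥sᶜ → W, ∀ x, doubleRight M B (g' (ψ x)) = c x :=
    Classical.skolem.1 fun x : ↥sᶜ => (hc x).resolve_left x.2
  have hψB : ∀ x, g' (ψ x) ∉ B := by
    intro x hx
    obtain ⟨v, hv⟩ := hB ⟨hx, _, rfl⟩
    refine x.2 ⟨v, ?_⟩
    rw [← hψ, Function.comp_apply, doubleRight_of_mem hx, hv]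
  have hmixed : ∀ (x : s) (y : ↥sᶜ), K.graph.Adj x y → G'.Adj (φ' x) (ψ y) := by
    intro x y hxy
    have hadj := c.map_adj hxy
    rw [← hφ, ← hψ] at hadj
    obtain ⟨hadj, hxB⟩ := (double_adj_left_right (hψB y)).1 hadj
    rwa [← g'.map_adj_iff, hφ' x _ hxB rfl]
  refine ⟨fun x => if hx : x ∈ s then φ' ⟨x, hx⟩ else ψ ⟨x, hx⟩, fun {x y} hxy => ?_⟩
  by_cases hx : x ∈ s <;> by_cases hy : y ∈ s <;> simp only [hx, hy, dite_true, dite_false]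
  · exact φ'.map_adj (show (K.graph.induce s).Adj ⟨x, hx⟩ ⟨y, hy⟩ from hxy)
  · exact hmixed ⟨x, hx⟩ ⟨y, hy⟩ hxy
  · exact (hmixed ⟨y, hy⟩ ⟨x, hx⟩ hxy.symm).symm
  · rw [← g'.map_adj_iff, ← (doubleRight M B).map_adj_iff, hψ ⟨x, hx⟩, hψ ⟨y, hy⟩]
    exact c.map_adj hxy

theorem exType_eq_of_traces_subset (hH : IsHomClosed H) (hM : Omits C (double M B))
    (hG : IsExistentiallyComplete (C ∪ H) G) (hG' : IsExistentiallyComplete (C ∪ H) G')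
    {g : G ↪g M} {g' : G' ↪g M} (hB : B ∩ Set.range g' ⊆ Set.range g)
    (ht : traces H B g ⊆ traces H B g') {a : Fin n → V} {b : Fin n → W}
    (hab : ∀ i, g (a i) = g' (b i)) (haB : ∀ i, g (a i) ∈ B) : exType G a = exType G' b := by
  let T := Set.range (doubleLeft M B ∘ g) ∪ Set.range (doubleRight M B ∘ g')
  let ι := SimpleGraph.Embedding.induce (G := double M B) T
  have homits : Omits (C ∪ H) ((double M B).induce T) := by
    rintro K (hK | hK) ⟨c⟩
    · exact hM.of_embedding ι K hK ⟨c⟩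
    · obtain ⟨φ⟩ := nonempty_hom_of_traces_subset hB ht hK (ι.toHom.comp c.toHom)
        fun x => (c x).2
      exact (hH.isEmpty_hom (fun K hK => hG'.1.2 K (.inr hK)) hK).false φ
  obtain ⟨e, he⟩ := exists_embedding_induce ((doubleLeft M B).comp g) (T := T)
    Set.subset_union_left
  obtain ⟨e', he'⟩ := exists_embedding_induce ((doubleRight M B).comp g') (T := T)
    Set.subset_union_right
  have hee' : e ∘ a = e' ∘ b := by
    refine funext fun i => Subtype.ext ((he _).trans (Eq.trans ?_ (he' _).symm))
    change doubleLeft M B (g (a i)) = doubleRight M B (g' (b i))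
    rw [← hab, doubleRight_of_mem (haB i)]
  rw [← hG.exType_comp_eq homits e, ← hG'.exType_comp_eq homits e', hee']

theorem finite_setOf_exType_of_omits_double (hHfin : H.Finite) (hH : IsHomClosed H)
    (hB : B.Finite) (hM : Omits C (double M B)) {a : Fin n → U} (ha : ∀ i, a i ∈ B) :
    {t | ∃ (V : Type) (G : SimpleGraph V) (b : Fin n → V) (g : G ↪g M),
      IsExistentiallyComplete (C ∪ H) G ∧ g ∘ b = a ∧ exType G b = t}.Finite := by
  have := hHfin.to_subtype
  have := hB.to_subtype
  refine Set.finite_coe_iff.1 ?_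
  choose V G b g hG hb ht using fun t : {t | ∃ (V : Type) (G : SimpleGraph V) (b : Fin n → V)
    (g : G ↪g M), IsExistentiallyComplete (C ∪ H) G ∧ g ∘ b = a ∧ exType G b = t} => t.2
  refine Finite.of_injective
    (fun t => (((↑) ⁻¹' Set.range (g t) : Set B), traces H B (g t))) fun t t' h => ?_
  obtain ⟨hrange, htraces⟩ := Prod.ext_iff.1 h
  refine Subtype.ext ((ht t).symm.trans (Eq.trans ?_ (ht t')))
  refine exType_eq_of_traces_subset hH hM (hG t) (hG t') (fun x hx => ?_) htraces.subset
    (fun i => ?_) fun i => ?_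
  · exact (Set.ext_iff.1 hrange ⟨x, hx.1⟩).2 hx.2
  · exact (congrFun (hb t) i).trans (congrFun (hb t') i).symm
  · exact (congrFun (hb t) i).symm.subst (ha i)

theorem FinitelyManyTypes.union (hC : FinitelyManyTypes C) (hM : IsExistentiallyComplete C M)
    (huniv : IsUniversal C M) (hHfin : H.Finite) (hH : IsHomClosed H) :
    FinitelyManyTypes (C ∪ H) := by
  intro n
  have hfin : (Set.range fun a : Fin n → U => exType M a).Finite :=
    (hC n).subset (Set.range_subset_iff.2 hM.exType_mem)
  have := hfin.to_subtype
  choose a ha using fun q : Set.range fun a : Fin n → U => exType M a => q.2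
  refine (Set.finite_iUnion fun q => finite_setOf_exType_of_omits_double (a := a q) hHfin hH
    (hC.finite_algClosure hM _) (hC.omits_double_algClosure hM _) (mem_algClosure M _)).subset ?_
  rintro _ ⟨V, G, b, hG, rfl⟩
  obtain ⟨g⟩ := huniv.2 V G ⟨hG.1.1, fun K hK => hG.1.2 K (.inl hK)⟩
  obtain ⟨σ, hσ⟩ := hC.typesIsolated.exists_iso hM hM (ha ⟨_, g ∘ b, rfl⟩).symm
  exact Set.mem_iUnion.2 ⟨⟨_, g ∘ b, rfl⟩, V, G, b, σ.toEmbedding.comp g, hG, hσ, rfl⟩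

end HomClosed

section Connected

variable {C : Set FinGraph} {V W : Type} {G : SimpleGraph V} {G' : SimpleGraph W}

theorem omits_sum (hconn : ∀ K ∈ C, K.graph.Connected) (hG : Omits C G) (hG' : Omits C G') :
    Omits C (G ⊕g G') := by
  rintro K hK ⟨c⟩
  have hside : ∀ x y, (c x).isLeft = (c y).isLeft := by
    intro x y
    obtain ⟨w⟩ := (hconn K hK).preconnected x y
    induction w with
    | nil => rfl
    | @cons u v _ huv _ ih =>
      have hadj : (G ⊕g G').Adj (c u) (c v) := c.toHom.map_adj huv
      rw [← ih]
      cases hu : c u <;> cases hv : c v <;> simp_all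
  obtain ⟨x₀⟩ := (hconn K hK).nonempty
  cases h₀ : (c x₀).isLeft
  · refine hG' K hK (isContained_of_range_subset c SimpleGraph.Embedding.sumInr ?_)
    rintro _ ⟨x, rfl⟩
    obtain ⟨y, hy⟩ := Sum.isRight_iff.1 (Sum.isLeft_eq_false.1 ((hside x x₀).trans h₀))
    exact ⟨y, hy.symm⟩
  · refine hG K hK (isContained_of_range_subset c SimpleGraph.Embedding.sumInl ?_)
    rintro _ ⟨x, rfl⟩
    obtain ⟨y, hy⟩ := Sum.isLeft_iff.1 ((hside x x₀).trans h₀)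
    exact ⟨y, hy.symm⟩

theorem FinitelyManyTypes.nonempty_iso (hC : FinitelyManyTypes C)
    (hconn : ∀ K ∈ C, K.graph.Connected) (hG : IsExistentiallyComplete C G)
    (hG' : IsExistentiallyComplete C G') : Nonempty (G ≃g G') := by
  have hsum := omits_sum hconn hG.1.2 hG'.1.2
  have htype : exType G (Fin.elim0 : Fin 0 → V) = exType G' (Fin.elim0 : Fin 0 → W) := by
    rw [← hG.exType_comp_eq hsum SimpleGraph.Embedding.sumInl,
      ← hG'.exType_comp_eq hsum SimpleGraph.Embedding.sumInr]
    exact congrArg _ (Subsingleton.elim _ _)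
  exact (hC.typesIsolated.exists_iso hG hG' htype).nonempty

theorem FinitelyManyTypes.isUniversal (hC : FinitelyManyTypes C)
    (hconn : ∀ K ∈ C, K.graph.Connected) (hG : IsExistentiallyComplete C G) :
    IsUniversal C G := by
  refine ⟨hG.1, fun W G' hG' => ?_⟩
  obtain ⟨_, _, hH, ⟨f⟩⟩ := exists_isExistentiallyComplete hG'
  obtain ⟨σ⟩ := hC.nonempty_iso hconn hH hG
  exact ⟨σ.toEmbedding.comp f⟩

theorem FinitelyManyTypes.categorical_and_universal (hC : FinitelyManyTypes C)
    (hconn : ∀ K ∈ C, K.graph.Connected) :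
    IsAlephZeroCategorical (theoryStar C) ∧
      ∃ (V : Type) (G : SimpleGraph V), IsUniversal C G := by
  have hempty : IsCountableFree C (⊥ : SimpleGraph Empty) :=
    ⟨inferInstance, fun K hK ⟨c⟩ => (hconn K hK).nonempty.elim fun x => (c x).elim⟩
  obtain ⟨V, G, hG, -⟩ := exists_isExistentiallyComplete hempty
  refine ⟨isAlephZeroCategorical_theoryStar_iff.2 ⟨⟨V, G, hG.1.1, hG.isModel⟩, ?_⟩,
    V, G, hC.isUniversal hconn hG⟩
  intro W W' H H' _ _ hH hH'
  exact hC.nonempty_iso hconn (hH.isExistentiallyComplete hC) (hH'.isExistentiallyComplete hC)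

end Connected

end ForbiddenGraphs

theorem theorem5_general (C H : Set FinGraph) (hCconn : ∀ K ∈ C, K.graph.Connected)
    (hCcat : IsAlephZeroCategorical (theoryStar C)) (hHfin : H.Finite)
    (hHconn : ∀ K ∈ H, K.graph.Connected) (hHhom : IsHomClosed H) :
    IsAlephZeroCategorical (theoryStar (C ∪ H)) ∧
      ∃ (V : Type) (G : SimpleGraph V), IsUniversal (C ∪ H) G := by
  have hC := finitelyManyTypes_of_categorical hCcat
  obtain ⟨V, M, hM⟩ := exists_isExistentiallyComplete_of_categorical hCcat
  have hunion := hC.union hM (hC.isUniversal hCconn hM) hHfin hHhom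
  exact hunion.categorical_and_universal fun K hK => hK.elim (hCconn K) (hHconn K)

theorem theorem5 (C H : Set FinGraph)
    (hCfin : C.Finite) (hCconn : ∀ K ∈ C, K.graph.Connected)
    (hCcat : IsAlephZeroCategorical (theoryStar C))
    (hHfin : H.Finite) (hHconn : ∀ K ∈ H, K.graph.Connected)
    (hHhom : IsHomClosed H) :
    IsAlephZeroCategorical (theoryStar (C ∪ H)) ∧
      ∃ (V : Type) (G : SimpleGraph V), IsUniversal (C ∪ H) G :=
  theorem5_general C H hCconn hCcat hHfin hHconn hHhom
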